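/- A recollement of abelian categories consists of abelian categories $\mathcal{A}_Z,\mathcal{A},\mathcal{A}_U$ and functors $i_*:\mathcal{A}_Z\to\mathcal{A}$, $i^*,i^!:\mathcal{A}\to\mathcal{A}_Z$, $j^*:\mathcal{A}\to\mathcal{A}_U$, $j_!,j_*:\mathcal{A}_U\to\mathcal{A}$ such that: $(i^*,i_*,i^!)$ and $(j_!,j^*,j_*)$ are adjoint triples; $i_*,j_!,j_*$ are fully faithful; $j^*i_*=0$; and for every object $X$ of $\mathcal{A}$ the adjunction maps give exact sequences $j_!j^*X\to X\to i_*i^*X\to 0$ and $0\to i_*i^!X\to X\to j_*j^*X$. An abelian category is a length category if every object has a finite filtration with simple subquotients. It is $\mathrm{Ext}^1$-finite if for all simple objects $A,B$ the group $\mathrm{Ext}^1(A,B)$ is finite-dimensional over the division ring $\mathrm{End}(B)$, which acts by composition. An epimorphism $\phi:X\to Y$ is essential if every morphism $\alpha:X'\to X$ with $\phi\circ\alpha$ an epimorphism is itself an epimorphism; a projective cover of $X$ is an essential epimorphism $P\to X$ with $P$ projective; dually, one defines essential monomorphisms and injective envelopes. An abelian category has enough projectives (resp. enough injectives) if every object has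 a projective cover (resp. an injective envelope). **Theorem.** Let $\mathcal{A}$ be an abelian length category with finitely many simple objects up to isomorphism, and let $(\mathcal{A}_Z,\mathcal{A},\mathcal{A}_U)$ be a recollement of abelian categories. If $\mathcal{A}$ is $\mathrm{Ext}^1$-finite, then $\mathcal{A}$ has enough projectives if and only if both $\mathcal{A}_Z$ and $\mathcal{A}_U$ have enough projectives. Dually, if $\mathcal{A}^{\mathrm{op}}$ is $\mathrm{Ext}^1$-finite, then $\mathcal{A}$ has enough injectives if and only if both $\mathcal{A}_Z$ and $\mathcal{A}_U$ have enough injectives. -/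

import Mathlib

open CategoryTheory CategoryTheory.Limits CategoryTheory.Abelian

universe w v u v₁ u₁ v₂ u₂

namespace AbelianRecollement

section Essential

variable {C : Type u} [Category.{v} C]

/-- An essential surjection: an epimorphism `f : X ⟶ Y` such that every `α : X' ⟶ X` whose
composite with `f` is an epimorphism is itself an epimorphism. -/
def IsEssentialEpi {X Y : C} (f : X ⟶ Y) : Prop :=
  Epi f ∧ ∀ ⦃X' : C⦄ (α : X' ⟶ X), Epi (α ≫ f) → Epi α

/-- An essential extension: a monomorphism `f : X ⟶ Y` such that every `β : Y ⟶ Y'` whose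
composite with `f` is a monomorphism is itself a monomorphism. -/
def IsEssentialMono {X Y : C} (f : X ⟶ Y) : Prop :=
  Mono f ∧ ∀ ⦃Y' : C⦄ (β : Y ⟶ Y'), Mono (f ≫ β) → Mono β

/-- `π : P ⟶ X` is a projective cover of `X`. -/
def IsProjectiveCover {P X : C} (π : P ⟶ X) : Prop :=
  Projective P ∧ IsEssentialEpi π

/-- `ι : X ⟶ I` is an injective envelope of `X`. -/
def IsInjectiveEnvelope {X I : C} (ι : X ⟶ I) : Prop :=
  Injective I ∧ IsEssentialMono ι

variable (C) in
/-- Every object has a projective cover. -/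
def HasEnoughProjectives : Prop :=
  ∀ X : C, ∃ (P : C) (π : P ⟶ X), IsProjectiveCover π

variable (C) in
/-- Every object has an injective envelope. -/
def HasEnoughInjectives : Prop :=
  ∀ X : C, ∃ (I : C) (ι : X ⟶ I), IsInjectiveEnvelope ι

end Essential

section Finiteness

variable (C : Type u) [Category.{v} C] [Abelian C]

/-- Every object has a finite filtration `⊥ = F 0 ≤ F 1 ≤ ⋯ ≤ F n = ⊤` by subobjects
with simple subquotients `F (i + 1) / F i`. -/
def IsLengthCategory : Prop :=
  ∀ X : C, ∃ (n : ℕ) (F : Fin (n + 1) →o Subobject X), F 0 = ⊥ ∧ F (Fin.last n) = ⊤ ∧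
    ∀ i : Fin n,
      Simple (cokernel (Subobject.ofLE (F i.castSucc) (F i.succ)
        (F.monotone i.castSucc_le_succ)))

/-- There are, up to isomorphism, only finitely many simple objects. -/
def HasFinitelyManySimples : Prop :=
  ∃ (n : ℕ) (S : Fin n → C), (∀ i, Simple (S i)) ∧
    ∀ X : C, Simple X → ∃ i, Nonempty (X ≅ S i)

variable {C}

/-- The left `End B`-module structure on `Ext A B n`, by composition (Yoneda product) with
endomorphisms of `B`. The multiplication of `End B` is composition of maps, `f * g = f ∘ g`. -/
noncomputable instance extModule [HasExt.{w} C] (A B : C) (n : ℕ) :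
    Module (End B) (Ext.{w} A B n) where
  smul f e := e.comp (Ext.mk₀ (End.asHom f)) (add_zero n)
  one_smul e := Ext.comp_mk₀_id e
  mul_smul f g e := by
    change e.comp (Ext.mk₀ (End.asHom g ≫ End.asHom f)) _ =
      (e.comp (Ext.mk₀ (End.asHom g)) _).comp (Ext.mk₀ (End.asHom f)) _
    rw [← Ext.mk₀_comp_mk₀, Ext.comp_assoc _ _ _ (add_zero n) (add_zero 0) (by simp)]
  smul_zero f := Ext.zero_comp A n (Ext.mk₀ (End.asHom f)) n (add_zero n)
  smul_add f e e' := Ext.add_comp _ _ _ _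
  add_smul f g e := by
    change e.comp (Ext.mk₀ (End.asHom f + End.asHom g)) _ = _
    rw [Ext.mk₀_add, Ext.comp_add]
    rfl
  zero_smul e := by
    change e.comp (Ext.mk₀ (0 : B ⟶ B)) _ = 0
    rw [Ext.mk₀_zero, Ext.comp_zero]

variable (C) in
/-- `Extᵏ`-finiteness: for simple objects `A`, `B`, the module `Extᵏ(A, B)` over the division
ring `End B` is finite dimensional. -/
def IsExtFinite (k : ℕ) : Prop :=
  letI := HasExt.standard C
  ∀ A B : C, Simple A → Simple B → Module.Finite (End B) (Ext.{max u v} A B k)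

end Finiteness

/-- A recollement of abelian categories
`AZ ⥤ A ⥤ AU`, consisting of the functors `i_*, i^*, i^!` and `j^*, j_!, j_*`. -/
structure Recollement (AZ : Type u₁) [Category.{v₁} AZ] [Abelian AZ]
    (A : Type u) [Category.{v} A] [Abelian A]
    (AU : Type u₂) [Category.{v₂} AU] [Abelian AU] where
  /-- `i_*` -/
  iLowerStar : AZ ⥤ A
  /-- `i^*` -/
  iUpperStar : A ⥤ AZ
  /-- `i^!` -/
  iUpperShriek : A ⥤ AZ
  /-- `j^*` -/
  jUpperStar : A ⥤ AU
  /-- `j_!` -/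
  jLowerShriek : AU ⥤ A
  /-- `j_*` -/
  jLowerStar : AU ⥤ A
  /-- `i^* ⊣ i_*` -/
  adjIStar : iUpperStar ⊣ iLowerStar
  /-- `i_* ⊣ i^!` -/
  adjIShriek : iLowerStar ⊣ iUpperShriek
  /-- `j_! ⊣ j^*` -/
  adjJShriek : jLowerShriek ⊣ jUpperStar
  /-- `j^* ⊣ j_*` -/
  adjJStar : jUpperStar ⊣ jLowerStar
  full_iLowerStar : iLowerStar.Full
  faithful_iLowerStar : iLowerStar.Faithful
  full_jLowerShriek : jLowerShriek.Full
  faithful_jLowerShriek : jLowerShriek.Faithful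
  full_jLowerStar : jLowerStar.Full
  faithful_jLowerStar : jLowerStar.Faithful
  /-- `j^* i_* = 0` -/
  isZero_jUpperStar_iLowerStar : ∀ Z : AZ, IsZero (jUpperStar.obj (iLowerStar.obj Z))
  /-- `j_! j^* X ⟶ X ⟶ i_* i^* X ⟶ 0` is exact. -/
  exact_right : ∀ X : A,
    ∃ h : adjJShriek.counit.app X ≫ adjIStar.unit.app X = 0,
      (ShortComplex.mk _ _ h).Exact ∧ Epi (adjIStar.unit.app X)
  /-- `0 ⟶ i_* i^! X ⟶ X ⟶ j_* j^* X` is exact. -/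
  exact_left : ∀ X : A,
    ∃ h : adjIShriek.counit.app X ≫ adjJStar.unit.app X = 0,
      (ShortComplex.mk _ _ h).Exact ∧ Mono (adjIShriek.counit.app X)

end AbelianRecollement

/-! Descent of projective covers is formal. `i^*` and `j_!` have right adjoints preserving
epimorphisms, so they preserve projectives. A cover of `i_* X` yields one of `X` by applying `i^*`;
a cover `P` of `j_! X` satisfies `P ≅ j_! j^* P`, and `j^* P` covers `X`.

For the converse, a length argument replaces any explicit construction. If essential epimorphisms
onto `M` have sources of bounded length, one of maximal length has a projective source, since every
epimorphism onto that source splits (`exists_projectiveCover`). To bound the length of an essential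
`X ⟶ M`, let `K` be the kernel of `X ⟶ i_* i^* X`. The quotient `i_* i^* X` is covered by `i_* P`,
where `P` is a projective cover of `i^* M` (`exists_epi_of_essential`). Since `i^* K = 0`, every
simple quotient `S` of `K` has `j^* S ≠ 0`, hence is a quotient of a projective `j_! Q`. The length
of `Hom(K, S)` over `End S` is at most that of `Hom(M, S)` plus that of `Ext¹(i_* i^* X, S)`, which
is bounded by `Ext¹`-finiteness. Peeling off images of the projectives `j_! Q` then bounds the
length of `K` (`le_mul_of_sum_length_le`).

The statement on injectives is the same theorem for the opposite recollement. -/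

namespace AbelianRecollement

/-! ### Jordan–Hölder length -/

section Length

variable {C : Type u} [Category.{v} C] [Abelian C]

/-- A natural-number valued function on objects that is additive on short exact sequences and
vanishes only on zero objects. -/
structure IsLengthFunction (l : C → ℕ) : Prop where
  add : ∀ S : ShortComplex C, S.ShortExact → l S.X₂ = l S.X₁ + l S.X₃
  isZero : ∀ X, l X = 0 → IsZero X

/-- `HasLength n X`: the object `X` has a filtration with `n` simple subquotients. -/
inductive HasLength : ℕ → C → Prop
  | zero {X : C} (h : IsZero X) : HasLength 0 X
  | succ {n : ℕ} {X T : C} (p : X ⟶ T) (hp : Epi p) (hT : Simple T)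
      (h : HasLength n (kernel p)) : HasLength (n + 1) X

lemma HasLength.of_iso {n : ℕ} {X Y : C} (h : HasLength n X) (e : X ≅ Y) : HasLength n Y := by
  induction h generalizing Y with
  | zero h => exact .zero (h.of_iso e.symm)
  | succ p hp hT _ ih => exact .succ (e.inv ≫ p) (epi_comp _ _) hT (ih (kernelIsIsoComp e.inv p).symm)

/-- The two iterated kernels of a pair of maps out of an object agree. -/
noncomputable def kernelKernelIso {X N T : C} (g : X ⟶ N) (p : X ⟶ T) :
    kernel (kernel.ι p ≫ g) ≅ kernel (kernel.ι g ≫ p) where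
  hom := kernel.lift _ (kernel.lift g (kernel.ι _ ≫ kernel.ι p) (by simp)) (by simp)
  inv := kernel.lift _ (kernel.lift p (kernel.ι _ ≫ kernel.ι g) (by simp)) (by simp)
  hom_inv_id := by
    apply equalizer.hom_ext; apply equalizer.hom_ext; simp
  inv_hom_id := by
    apply equalizer.hom_ext; apply equalizer.hom_ext; simp

/-- The map `ker (g ≫ q) ⟶ ker q` induced by `g`. -/
noncomputable abbrev kernelCompMap {X N T : C} (g : X ⟶ N) (q : N ⟶ T) : kernel (g ≫ q) ⟶ kernel q :=
  kernel.lift q (kernel.ι (g ≫ q) ≫ g) (by simp)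

instance epi_kernelCompMap {X N T : C} (g : X ⟶ N) [Epi g] (q : N ⟶ T) : Epi (kernelCompMap g q) := by
  rw [epi_iff_surjective_up_to_refinements]
  intro A y
  obtain ⟨A', π, hπ, x, hx⟩ := surjective_up_to_refinements_of_epi g (y ≫ kernel.ι q)
  refine ⟨A', π, hπ, kernel.lift _ x ?_, ?_⟩
  · rw [← Category.assoc, ← hx]; simp
  · apply equalizer.hom_ext; simpa using hx

/-- The kernel of `ker (g ≫ q) ⟶ ker q` is the kernel of `g`. -/
noncomputable def kernelKernelCompMapIso {X N T : C} (g : X ⟶ N) (q : N ⟶ T) :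
    kernel (kernelCompMap g q) ≅ kernel g where
  hom := kernel.lift _ (kernel.ι _ ≫ kernel.ι _) (by
    have : kernel.ι (kernelCompMap g q) ≫ kernel.ι (g ≫ q) ≫ g =
      kernel.ι (kernelCompMap g q) ≫ kernelCompMap g q ≫ kernel.ι q := by rw [kernel.lift_ι]
    rw [Category.assoc, this, kernel.condition_assoc, zero_comp])
  inv := kernel.lift _ (kernel.lift _ (kernel.ι g) (by simp)) (by
    apply equalizer.hom_ext; simp)
  hom_inv_id := by
    apply equalizer.hom_ext; apply equalizer.hom_ext; simp
  inv_hom_id := by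
    apply equalizer.hom_ext; simp

/-- If `ker g` surjects onto `T`, then `X = ker g + ker p`, so `ker p` surjects onto `X / ker g`. -/
lemma epi_kernel_ι_comp {X N T : C} (g : X ⟶ N) [Epi g] (p : X ⟶ T) [Epi p]
    [Epi (kernel.ι g ≫ p)] : Epi (kernel.ι p ≫ g) := by
  apply Preadditive.epi_of_cancel_zero
  intro W h hh
  have h1 : kernel.ι p ≫ g ≫ h = 0 := by simpa using hh
  have h2 := Abelian.comp_epiDesc p (g ≫ h) h1
  have h3 : Abelian.epiDesc p (g ≫ h) h1 = 0 := by
    rw [← cancel_epi (kernel.ι g ≫ p)]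
    simp [h2]
  rw [h3, comp_zero] at h2
  rw [← cancel_epi g, ← h2, comp_zero]

/-- The top factor `T` goes to `N` or to `ker g`, according to whether `p` factors through `g`; by
simplicity of `T`, otherwise `ker g` surjects onto it. -/
lemma HasLength.split {n : ℕ} {X : C} (h : HasLength n X) {N : C} (g : X ⟶ N) [Epi g] :
    ∃ a b, a + b = n ∧ HasLength a (kernel g) ∧ HasLength b N := by
  induction h generalizing N with
  | zero h =>
    refine ⟨0, 0, rfl, .zero (h.of_mono (kernel.ι g)), .zero (h.of_epi g)⟩
  | @succ n X T p hp hT hk ih =>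
    by_cases hu : kernel.ι g ≫ p = 0
    · obtain ⟨q, rfl⟩ : ∃ q, g ≫ q = p := ⟨Abelian.epiDesc g p hu, Abelian.comp_epiDesc g p hu⟩
      obtain ⟨a, b, hab, ha, hb⟩ := ih (kernelCompMap g q)
      exact ⟨a, b + 1, by omega, ha.of_iso (kernelKernelCompMapIso g q),
        .succ q (epi_of_epi g q) hT hb⟩
    · have hu' : Epi (kernel.ι g ≫ p) := epi_of_nonzero_to_simple hu
      have : Epi (kernel.ι p ≫ g) := epi_kernel_ι_comp g p
      obtain ⟨a, b, hab, ha, hb⟩ := ih (kernel.ι p ≫ g)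
      exact ⟨a + 1, b, by omega, .succ _ hu' hT (ha.of_iso (kernelKernelIso g p)), hb⟩

lemma HasLength.join {b : ℕ} {N : C} (hN : HasLength b N) {a : ℕ} {X : C} (g : X ⟶ N) [Epi g]
    (hK : HasLength a (kernel g)) : HasLength (a + b) X := by
  induction hN generalizing X with
  | zero h =>
    have : g = 0 := h.eq_of_tgt _ _
    have : IsIso (kernel.ι g) := by subst this; infer_instance
    exact hK.of_iso (asIso (kernel.ι g))
  | @succ n N T p hp hT hk ih =>
    exact .succ (g ≫ p) (epi_comp _ _) hT
      (ih (kernelCompMap g p) (hK.of_iso (kernelKernelCompMapIso g p).symm))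

lemma HasLength.eq_zero {n : ℕ} {X : C} (h : HasLength n X) (hX : IsZero X) : n = 0 := by
  cases h with
  | zero => rfl
  | succ p hp hT h => exact (Simple.not_isZero _ (hX.of_epi p)).elim

lemma HasLength.eq_one {n : ℕ} {X : C} (h : HasLength n X) (hX : Simple X) : n = 1 := by
  cases h with
  | zero h => exact (Simple.not_isZero X h).elim
  | succ p hp hT h =>
    have hp0 : p ≠ 0 := fun hp0 => Simple.not_isZero _ (IsZero.of_epi_eq_zero p hp0)
    have := isIso_of_epi_of_nonzero hp0
    rw [h.eq_zero ((isZero_zero C).of_iso (kernel.ofMono p))]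

/-- Splitting the second filtration along the top quotient of the first reduces to the kernel,
because a simple object has only length one. -/
lemma HasLength.unique {m n : ℕ} {X : C} (h : HasLength m X) (h' : HasLength n X) : m = n := by
  induction h generalizing n with
  | zero h => exact (h'.eq_zero h).symm
  | succ p hp hT _ ih =>
    obtain ⟨a, b, rfl, ha, hb⟩ := h'.split p
    rw [ih ha, hb.eq_one hT]

lemma HasLength.of_shortExact {a b : ℕ} {S : ShortComplex C} (hS : S.ShortExact)
    (h₁ : HasLength a S.X₁) (h₃ : HasLength b S.X₃) : HasLength (a + b) S.X₂ :=
  have := hS.epi_g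
  h₃.join S.g (h₁.of_iso (hS.fIsKernel.conePointUniqueUpToIso (limit.isLimit _)))

lemma IsLengthCategory.exists_hasLength (h : IsLengthCategory C) (X : C) :
    ∃ n, HasLength n X := by
  obtain ⟨n, F, h0, h1, hF⟩ := h X
  have key : ∀ i : Fin (n + 1), HasLength i.val (F i : C) := by
    intro i
    induction i using Fin.induction with
    | zero =>
      rw [h0]
      exact .zero ((isZero_zero C).of_iso Subobject.botCoeIsoZero)
    | succ i ih =>
      have hS : (ShortComplex.mk (Subobject.ofLE (F i.castSucc) (F i.succ)
        (F.monotone i.castSucc_le_succ)) _ (cokernel.condition _)).ShortExact :=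
        { exact := ShortComplex.exact_cokernel _
          mono_f := by dsimp; infer_instance
          epi_g := by dsimp; infer_instance }
      have h1 : HasLength 1 (cokernel (Subobject.ofLE (F i.castSucc) (F i.succ)
        (F.monotone i.castSucc_le_succ))) :=
        .succ (𝟙 _) inferInstance (hF i) (.zero ((isZero_zero C).of_iso (kernel.ofMono _)))
      exact HasLength.of_shortExact hS ih h1
  have := key (Fin.last n)
  rw [h1] at this
  exact ⟨_, this.of_iso (asIso (⊤ : Subobject X).arrow)⟩

lemma IsLengthCategory.exists_isLengthFunction (h : IsLengthCategory C) :
    ∃ l : C → ℕ, IsLengthFunction l := by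
  choose l hl using h.exists_hasLength
  refine ⟨l, fun S hS => (hl _).unique (HasLength.of_shortExact hS (hl _) (hl _)), fun X hX => ?_⟩
  have := hl X
  rw [hX] at this
  cases this with
  | zero h => exact h

end Length

end AbelianRecollement

namespace AbelianRecollement

/-! ### Length functions and projective covers of maximal length -/

section Bounded

variable {C : Type u} [Category.{v} C] [Abelian C] {l : C → ℕ}

namespace IsLengthFunction

variable (hl : IsLengthFunction l)
include hl

lemma add_kernel {X N : C} (g : X ⟶ N) [Epi g] : l X = l (kernel g) + l N :=
  hl.add (ShortComplex.mk (kernel.ι g) g (kernel.condition g))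
    { exact := ShortComplex.exact_kernel g
      mono_f := by dsimp; infer_instance
      epi_g := by dsimp; infer_instance }

lemma add_cokernel {K X : C} (f : K ⟶ X) [Mono f] : l X = l K + l (cokernel f) :=
  hl.add (ShortComplex.mk f (cokernel.π f) (cokernel.condition f))
    { exact := ShortComplex.exact_cokernel f
      mono_f := by dsimp; infer_instance
      epi_g := by dsimp; infer_instance }

lemma le_of_epi {X N : C} (g : X ⟶ N) [Epi g] : l N ≤ l X := by
  have := hl.add_kernel g; omega

lemma isIso_of_epi {X N : C} (g : X ⟶ N) [Epi g] (h : l X ≤ l N) : IsIso g := by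
  have h0 := hl.add_kernel g
  have hk := hl.isZero (kernel g) (by omega)
  have : Mono g := Preadditive.mono_of_isZero_kernel g hk
  exact isIso_of_mono_of_epi g

lemma isIso_of_mono {K X : C} (f : K ⟶ X) [Mono f] (h : l X ≤ l K) : IsIso f := by
  have h0 := hl.add_cokernel f
  have hk := hl.isZero (cokernel f) (by omega)
  have : Epi f := Preadditive.epi_of_isZero_cokernel f hk
  exact isIso_of_mono_of_epi f

/-- A right exact sequence bounds the length of its middle term. -/
lemma le_add_cokernel {K X : C} (f : K ⟶ X) : l X ≤ l K + l (cokernel f) := by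
  have h1 := hl.add_kernel (cokernel.π f)
  have h2 := hl.le_of_epi (Abelian.factorThruImage f)
  have : kernel (cokernel.π f) = Abelian.image f := rfl
  rw [← this] at h2
  omega

/-- Every nonzero object has a simple quotient. -/
lemma exists_simple_quotient {X : C} (hX : ¬ IsZero X) :
    ∃ (T : C) (p : X ⟶ T), Epi p ∧ Simple T := by
  obtain ⟨n, hn⟩ : ∃ n, l X = n := ⟨_, rfl⟩
  induction n using Nat.strong_induction_on generalizing X with
  | _ n ih =>
  by_cases h : ∃ (N : C) (g : X ⟶ N), Epi g ∧ ¬ IsZero N ∧ l N < n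
  · obtain ⟨N, g, hg, hN, hlt⟩ := h
    obtain ⟨T, p, hp, hT⟩ := ih _ hlt hN rfl
    exact ⟨T, g ≫ p, epi_comp _ _, hT⟩
  · push Not at h
    refine ⟨X, 𝟙 X, inferInstance, simple_of_cosimple X fun {Z} f hf => ⟨?_, fun hf0 => ?_⟩⟩
    · rintro hi rfl
      exact hX (IsZero.of_mono_eq_zero (0 : X ⟶ Z) rfl)
    · refine hl.isIso_of_epi f ?_
      rw [hn]
      exact h Z f hf fun hZ => hf0 (hZ.eq_of_tgt _ _)

end IsLengthFunction

lemma IsEssentialEpi.comp {C : Type u} [Category.{v} C] {X Y Z : C} {f : X ⟶ Y} {g : Y ⟶ Z}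
    (hf : IsEssentialEpi f) (hg : IsEssentialEpi g) : IsEssentialEpi (f ≫ g) := by
  have := hf.1
  have := hg.1
  refine ⟨epi_comp _ _, fun X' α h => hf.2 _ (hg.2 _ ?_)⟩
  rwa [Category.assoc]

lemma projective_of_split {P : C} (h : ∀ (Y : C) (e : Y ⟶ P), Epi e → ∃ s, s ≫ e = 𝟙 P) :
    Projective P where
  factors {E X} f e he := by
    obtain ⟨s, hs⟩ := h _ (pullback.fst f e) inferInstance
    exact ⟨s ≫ pullback.snd f e, by rw [Category.assoc, ← pullback.condition, reassoc_of% hs]⟩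

/-- In a length category, every epimorphism restricts to an essential epimorphism on some
subobject of its source. -/
lemma IsLengthFunction.exists_essential (hl : IsLengthFunction l) {Y P : C} (e : Y ⟶ P) [Epi e] :
    ∃ (Y' : C) (m : Y' ⟶ Y), IsEssentialEpi (m ≫ e) := by
  have hex : ∃ n, ∃ (Y' : C) (m : Y' ⟶ Y), l Y' = n ∧ Epi (m ≫ e) :=
    ⟨_, Y, 𝟙 Y, rfl, by rw [Category.id_comp]; infer_instance⟩
  classical
  -- Choose a source of minimal length still surjecting onto `P`; the image of any competing `α`
  -- also surjects, so by minimality it is all of `Y'`.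
  obtain ⟨Y', m, hm, he⟩ := Nat.find_spec hex
  refine ⟨Y', m, he, fun Z α hα => ?_⟩
  have h2 : Epi (Limits.image.ι α ≫ m ≫ e) := by
    have : Epi (Limits.factorThruImage α ≫ Limits.image.ι α ≫ m ≫ e) := by
      rw [Limits.image.fac_assoc]; exact hα
    exact epi_of_epi (Limits.factorThruImage α) _
  have h3 := Nat.find_min' hex ⟨_, Limits.image.ι α ≫ m, rfl, by rwa [Category.assoc]⟩
  have := hl.isIso_of_mono (Limits.image.ι α) (hm.trans_le h3)
  rw [← Limits.image.fac α]
  exact epi_comp _ _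

/-- If the essential epimorphisms onto `M` have sources of bounded length, then `M` has a
projective cover. -/
lemma IsLengthFunction.exists_projectiveCover (hl : IsLengthFunction l) (M : C) (N : ℕ)
    (hN : ∀ (X : C) (f : X ⟶ M), IsEssentialEpi f → l X ≤ N) :
    ∃ (P : C) (π : P ⟶ M), IsProjectiveCover π := by
  have hmax : ∃ (P : C) (π : P ⟶ M), IsEssentialEpi π ∧
      ∀ (X : C) (f : X ⟶ M), IsEssentialEpi f → l X ≤ l P := by
    let p : ℕ → Prop := fun n => ∃ (X : C) (f : X ⟶ M), IsEssentialEpi f ∧ l X = n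
    have hb : ∀ n, p n → n ≤ N := by
      rintro _ ⟨X, f, hf, rfl⟩
      exact hN X f hf
    have h0 : p (l M) := ⟨M, 𝟙 M, ⟨inferInstance, fun X' α h => by simpa using h⟩, rfl⟩
    classical
    obtain ⟨P, π, hπ, hP⟩ := Nat.findGreatest_spec (P := p) (hb _ h0) h0
    refine ⟨P, π, hπ, fun X f hf => ?_⟩
    rw [hP]
    exact Nat.le_findGreatest (hN X f hf) ⟨X, f, hf, rfl⟩
  obtain ⟨P, π, hπ, hP⟩ := hmax
  refine ⟨P, π, projective_of_split fun Y e he => ?_, hπ⟩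
  -- The composite `Y' ⟶ P ⟶ M` is again essential, so maximality of `l P` makes `Y' ⟶ P` an
  -- isomorphism, which splits `e`.
  obtain ⟨Y', m, hm⟩ := hl.exists_essential e
  have := hm.1
  have := hl.isIso_of_epi (m ≫ e) (hP _ _ (hm.comp hπ))
  exact ⟨inv (m ≫ e) ≫ m, by simp⟩

end Bounded

end AbelianRecollement

namespace AbelianRecollement

/-! ### Projective covers descend to the closed and open parts -/

namespace Recollement

attribute [instance] full_iLowerStar faithful_iLowerStar full_jLowerShriek faithful_jLowerShriek
  full_jLowerStar faithful_jLowerStar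

variable {AZ : Type u₁} [Category.{v₁} AZ] [Abelian AZ] {A : Type u} [Category.{v} A] [Abelian A]
  {AU : Type u₂} [Category.{v₂} AU] [Abelian AU]
  (R : Recollement AZ A AU)

instance : R.iLowerStar.PreservesEpimorphisms :=
  Functor.preservesEpimorphisms_of_adjunction R.adjIShriek

instance : R.iUpperStar.PreservesEpimorphisms :=
  Functor.preservesEpimorphisms_of_adjunction R.adjIStar

instance : R.jUpperStar.PreservesEpimorphisms :=
  Functor.preservesEpimorphisms_of_adjunction R.adjJStar

instance : R.jLowerShriek.PreservesEpimorphisms :=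
  Functor.preservesEpimorphisms_of_adjunction R.adjJShriek

instance (X : A) : Epi (R.adjIStar.unit.app X) := (R.exact_right X).2.2

/-- By the two adjunctions, endomorphisms of `i^* j_! Y` correspond to maps into an object `j^* i_*
Z = 0`. -/
lemma isZero_iUpperStar_jLowerShriek (Y : AU) :
    IsZero (R.iUpperStar.obj (R.jLowerShriek.obj Y)) := by
  rw [IsZero.iff_id_eq_zero]
  apply (R.adjIStar.homEquiv _ _).injective
  apply (R.adjJShriek.homEquiv _ _).injective
  exact (R.isZero_jUpperStar_iLowerStar _).eq_of_tgt _ _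

lemma epi_counit_of_isZero {X : A} (h : IsZero (R.iUpperStar.obj X)) :
    Epi (R.adjJShriek.counit.app X) := by
  obtain ⟨w, hex, -⟩ := R.exact_right X
  exact hex.epi_f ((R.iLowerStar.map_isZero h).eq_of_tgt _ _)

instance epi_counit_jLowerShriek (Y : AU) :
    Epi (R.adjJShriek.counit.app (R.jLowerShriek.obj Y)) :=
  epi_of_epi_fac (R.adjJShriek.left_triangle_components Y)

theorem hasEnoughProjectives_closed (R : Recollement AZ A AU) (h : HasEnoughProjectives A) :
    HasEnoughProjectives AZ := by
  intro X
  obtain ⟨P, π, hP, hπ, hess⟩ := h (R.iLowerStar.obj X)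
  obtain ⟨g, rfl⟩ : ∃ g : R.iUpperStar.obj P ⟶ X, R.adjIStar.unit.app P ≫ R.iLowerStar.map g = π :=
    ⟨(R.adjIStar.homEquiv P X).symm π, (R.adjIStar.homEquiv_unit ..).symm.trans
      (Equiv.apply_symm_apply _ _)⟩
  refine ⟨R.iUpperStar.obj P, g, R.adjIStar.map_projective P hP,
    R.iLowerStar.epi_of_epi_map (epi_of_epi (R.adjIStar.unit.app P) _), fun X' α hα => ?_⟩
  apply R.iLowerStar.epi_of_epi_map
  -- Essentiality of `π` only tests maps into `P`, so `i_* α` is pulled back along the unit `P ⟶ i_*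
  -- i^* P`.
  have hc := pullback.condition (f := R.adjIStar.unit.app P) (g := R.iLowerStar.map α)
  have h1 : Epi (pullback.fst (R.adjIStar.unit.app P) (R.iLowerStar.map α)) := by
    apply hess
    rw [reassoc_of% hc, ← Functor.map_comp]
    exact epi_comp _ _
  have h2 : Epi (pullback.snd (R.adjIStar.unit.app P) (R.iLowerStar.map α) ≫ R.iLowerStar.map α) := by
    rw [← hc]
    exact epi_comp _ _
  exact epi_of_epi (pullback.snd (R.adjIStar.unit.app P) (R.iLowerStar.map α)) _

/-- Projectivity gives a section `s` of the counit `c`. Since `j^* c` is invertible, `j^* s` is its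
two-sided inverse, and an endomorphism of `j_! j^* P` is detected by `j^*` through the adjunction.
-/
lemma isIso_counit_of_projective (P : A) [Projective P] [Epi (R.adjJShriek.counit.app P)] :
    IsIso (R.adjJShriek.counit.app P) := by
  let c : R.jLowerShriek.obj (R.jUpperStar.obj P) ⟶ P := R.adjJShriek.counit.app P
  have hc : Epi c := ‹Epi (R.adjJShriek.counit.app P)›
  obtain ⟨s, hs⟩ : ∃ s, s ≫ c = 𝟙 P := ⟨Projective.factorThru (𝟙 P) c, by simp⟩
  have tri : R.adjJShriek.unit.app (R.jUpperStar.obj P) ≫ R.jUpperStar.map c = 𝟙 _ :=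
    R.adjJShriek.right_triangle_components P
  have hi : IsIso (R.jUpperStar.map c) := by
    rw [← IsIso.inv_eq_of_hom_inv_id tri]
    infer_instance
  have hjs : R.jUpperStar.map s ≫ R.jUpperStar.map c = 𝟙 _ := by
    rw [← CategoryTheory.Functor.map_comp, hs, CategoryTheory.Functor.map_id]
  refine ⟨s, ?_, hs⟩
  change c ≫ s = 𝟙 (R.jLowerShriek.obj (R.jUpperStar.obj P))
  apply (R.adjJShriek.homEquiv _ _).injective
  rw [Adjunction.homEquiv_unit, Adjunction.homEquiv_unit, CategoryTheory.Functor.map_comp,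
    CategoryTheory.Functor.map_id]
  congr 1
  rw [← cancel_mono (R.jUpperStar.map c), Category.assoc, hjs, Category.comp_id, Category.id_comp]

theorem hasEnoughProjectives_open (R : Recollement AZ A AU) (h : HasEnoughProjectives A) :
    HasEnoughProjectives AU := by
  intro X
  obtain ⟨P, π, hP, hπ, hess⟩ := h (R.jLowerShriek.obj X)
  let c : R.jLowerShriek.obj (R.jUpperStar.obj P) ⟶ P := R.adjJShriek.counit.app P
  have nat : c ≫ π = R.jLowerShriek.map (R.jUpperStar.map π) ≫ R.adjJShriek.counit.app _ :=
    (R.adjJShriek.counit.naturality π).symm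
  -- The counit at `j_! X` is epi, so `j_! j^* P` already surjects onto `j_! X`.
  have hc : Epi c := hess c (by rw [nat]; exact epi_comp _ _)
  have hci : IsIso c := R.isIso_counit_of_projective P
  have hproj : Projective (R.jUpperStar.obj P) :=
    R.adjJShriek.projective_of_map_projective _ (Projective.of_iso (asIso c).symm hP)
  refine ⟨R.jUpperStar.obj P, R.jUpperStar.map π ≫ inv (R.adjJShriek.unit.app X), hproj,
    epi_comp _ _, fun X' α hα => ?_⟩
  have h1 : Epi (α ≫ R.jUpperStar.map π) := by
    have : Epi ((α ≫ R.jUpperStar.map π ≫ inv (R.adjJShriek.unit.app X)) ≫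
      R.adjJShriek.unit.app X) := epi_comp _ _
    simpa using this
  have h2 : Epi (R.jLowerShriek.map α ≫ c) := by
    apply hess
    rw [Category.assoc, nat, ← Functor.map_comp_assoc]
    exact epi_comp _ _
  have h3 : Epi (R.jLowerShriek.map α) := by
    have : Epi ((R.jLowerShriek.map α ≫ c) ≫ inv c) := epi_comp _ _
    simpa using this
  exact R.jLowerShriek.epi_of_epi_map h3

end Recollement

end AbelianRecollement

namespace AbelianRecollement

/-! ### Length inequalities for modules -/

section ModuleLength

variable {R M N P : Type*} [Ring R] [AddCommGroup M] [Module R M] [AddCommGroup N] [Module R N]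
  [AddCommGroup P] [Module R P]

lemma length_le_add_of_exact (f : M →ₗ[R] N) (g : N →ₗ[R] P)
    (h : ∀ y, g y = 0 → ∃ x, f x = y) :
    Module.length R N ≤ Module.length R M + Module.length R P := by
  rw [Module.length_eq_add_of_exact (LinearMap.ker g).subtype g.rangeRestrict
    (Submodule.injective_subtype _) g.surjective_rangeRestrict
    (by rw [LinearMap.exact_iff]; simp)]
  refine add_le_add ?_ (Module.length_le_of_injective (LinearMap.range g).subtype
    (Submodule.injective_subtype _))
  have hle : LinearMap.ker g ≤ LinearMap.range f := fun y hy => h y hy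
  exact (Module.length_le_of_injective (Submodule.inclusion hle)
    (Submodule.inclusion_injective hle)).trans
    (Module.length_le_of_surjective f.rangeRestrict f.surjective_rangeRestrict)

lemma length_add_one_le (f : M →ₗ[R] N) (hf : Function.Injective f) (y : N)
    (hy : y ∉ LinearMap.range f) : Module.length R M + 1 ≤ Module.length R N := by
  rw [Module.length_eq_add_of_exact f (LinearMap.range f).mkQ hf (Submodule.mkQ_surjective _)
    (by rw [LinearMap.exact_iff]; simp)]
  have : Nontrivial (N ⧸ LinearMap.range f) :=
    Submodule.Quotient.nontrivial_iff.2 fun h => hy (h ▸ Submodule.mem_top)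
  exact add_le_add le_rfl (Order.one_le_iff_pos.2 Module.length_pos)

end ModuleLength

/-! ### Lengths of `Hom` and `Ext` into a simple object -/

section Hom

variable {C : Type u} [Category.{v} C] [Abelian C] {l : C → ℕ}

/-- Precomposition as a map linear over the endomorphism ring of the target. -/
def homPrecomp {X Y : C} (f : X ⟶ Y) (S : C) : (Y ⟶ S) →ₗ[End S] (X ⟶ S) where
  toFun h := f ≫ h
  map_add' _ _ := Preadditive.comp_add _ _ _ _ _ _
  map_smul' r h := (Category.assoc f h r).symm

/-- Precomposition on `Ext` as a map linear over the endomorphism ring of the target. -/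
noncomputable def extPrecomp [HasExt.{w} C] {X Y : C} (f : X ⟶ Y) (S : C) (n : ℕ) :
    Ext.{w} Y S n →ₗ[End S] Ext.{w} X S n where
  toFun e := (Ext.mk₀ f).comp e (zero_add n)
  map_add' _ _ := Ext.comp_add _ _ _ _
  map_smul' r e := (Ext.comp_assoc (Ext.mk₀ f) e (Ext.mk₀ (End.asHom r)) (zero_add n) (add_zero n)
    (by simp)).symm

/-- The connecting map of the contravariant long exact sequence, linear over the endomorphism
ring of the target. -/
noncomputable def extConnecting [HasExt.{w} C] {T : ShortComplex C} (hT : T.ShortExact) (S : C) :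
    (T.X₁ ⟶ S) →ₗ[End S] Ext.{w} T.X₃ S 1 where
  toFun h := hT.extClass.comp (Ext.mk₀ h) (add_zero 1)
  map_add' _ _ := by rw [Ext.mk₀_add, Ext.comp_add]
  map_smul' r h := by
    change hT.extClass.comp (Ext.mk₀ (h ≫ End.asHom r)) _ =
      (hT.extClass.comp (Ext.mk₀ h) _).comp (Ext.mk₀ (End.asHom r)) _
    rw [← Ext.mk₀_comp_mk₀, Ext.comp_assoc _ _ _ (add_zero 1) (add_zero 0) (by simp)]

lemma length_ne_top_of_finite (S : C) [Simple S] {M : Type*} [AddCommGroup M] [Module (End S) M]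
    [Module.Finite (End S) M] : Module.length (End S) M ≠ ⊤ := by
  have : IsArtinianRing (End S) := inferInstance
  exact Module.length_ne_top

/-- Schur's lemma: a nonzero map is an isomorphism and generates the whole module. -/
lemma finite_hom_of_simple (T S : C) [Simple T] [Simple S] : Module.Finite (End S) (T ⟶ S) := by
  by_cases h : ∃ f : T ⟶ S, f ≠ 0
  · obtain ⟨f, hf⟩ := h
    have := isIso_of_hom_simple hf
    refine ⟨⟨{f}, ?_⟩⟩
    rw [eq_top_iff]
    intro g _
    rw [Finset.coe_singleton, Submodule.mem_span_singleton]
    exact ⟨End.of (inv f ≫ g), by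
      change f ≫ inv f ≫ g = g
      simp⟩
  · push Not at h
    have : Subsingleton (T ⟶ S) := ⟨fun a b => (h a).trans (h b).symm⟩
    infer_instance

lemma length_hom_le_add {T : ShortComplex C} (hT : T.ShortExact) (S : C) :
    Module.length (End S) (T.X₂ ⟶ S) ≤
      Module.length (End S) (T.X₃ ⟶ S) + Module.length (End S) (T.X₁ ⟶ S) :=
  have := hT.epi_g
  length_le_add_of_exact (homPrecomp T.g S) (homPrecomp T.f S) fun y hy =>
    ⟨hT.exact.desc y hy, hT.exact.g_desc y hy⟩

lemma length_ext_le_add [HasExt.{w} C] {T : ShortComplex C} (hT : T.ShortExact) (S : C) (n : ℕ) :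
    Module.length (End S) (Ext.{w} T.X₂ S n) ≤
      Module.length (End S) (Ext.{w} T.X₃ S n) + Module.length (End S) (Ext.{w} T.X₁ S n) :=
  length_le_add_of_exact (extPrecomp T.g S n) (extPrecomp T.f S n) fun y hy =>
    Ext.contravariant_sequence_exact₂ hT S y hy

lemma length_hom_le_add_ext [HasExt.{w} C] {T : ShortComplex C} (hT : T.ShortExact) (S : C) :
    Module.length (End S) (T.X₁ ⟶ S) ≤
      Module.length (End S) (T.X₂ ⟶ S) + Module.length (End S) (Ext.{w} T.X₃ S 1) :=
  length_le_add_of_exact (homPrecomp T.f S) (extConnecting hT S) fun y hy => by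
    obtain ⟨x, hx⟩ := Ext.contravariant_sequence_exact₁ hT S (Ext.mk₀ y) (add_zero 1) hy
    obtain ⟨x, rfl⟩ := Ext.homEquiv₀.symm.surjective x
    refine ⟨x, ?_⟩
    rw [Ext.homEquiv₀_symm_apply, Ext.mk₀_comp_mk₀] at hx
    exact Ext.homEquiv₀.symm.injective hx

lemma shortExact_kernel {X T : C} (p : X ⟶ T) [Epi p] :
    (ShortComplex.mk (kernel.ι p) p (kernel.condition p)).ShortExact where
  exact := ShortComplex.exact_kernel p
  mono_f := by dsimp; infer_instance
  epi_g := by dsimp; infer_instance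

namespace IsLengthFunction

variable (hl : IsLengthFunction l)
include hl

lemma eq_zero {X : C} (hX : IsZero X) : l X = 0 := by
  have h1 := hl.add_kernel (𝟙 X)
  have : Epi (0 : kernel (𝟙 X) ⟶ X) := ⟨fun _ _ _ => hX.eq_of_src _ _⟩
  have h2 := hl.le_of_epi (0 : kernel (𝟙 X) ⟶ X)
  omega

lemma pos {X : C} (hX : ¬ IsZero X) : 0 < l X :=
  Nat.pos_of_ne_zero fun h => hX (hl.isZero X h)

/-- Induction on objects of a length category along extensions by simple quotients. -/
lemma induction_simple {motive : C → Prop} (zero : ∀ X, IsZero X → motive X)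
    (ext : ∀ (X T : C) (p : X ⟶ T), Epi p → Simple T → motive (kernel p) → motive X) (X : C) :
    motive X := by
  obtain ⟨n, hn⟩ : ∃ n, l X = n := ⟨_, rfl⟩
  induction n using Nat.strong_induction_on generalizing X with
  | _ n ih =>
  by_cases hX : IsZero X
  · exact zero X hX
  · obtain ⟨T, p, hp, hT⟩ := hl.exists_simple_quotient hX
    have h1 := hl.add_kernel p
    have h2 := hl.pos (Simple.not_isZero T)
    exact ext X T p hp hT (ih _ (by omega) _ rfl)

lemma length_hom_ne_top (S : C) [Simple S] (X : C) : Module.length (End S) (X ⟶ S) ≠ ⊤ := by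
  induction X using hl.induction_simple with
  | zero X hX =>
    have : Subsingleton (X ⟶ S) := ⟨fun _ _ => hX.eq_of_src _ _⟩
    simp
  | ext X T p hp hT ih =>
    have := finite_hom_of_simple T S
    exact ne_top_of_le_ne_top (WithTop.add_ne_top.2 ⟨length_ne_top_of_finite S, ih⟩)
      (length_hom_le_add (shortExact_kernel p) S)

lemma length_ext_le_mul [HasExt.{w} C] (S : C) (n c : ℕ)
    (hc : ∀ T : C, Simple T → Module.length (End S) (Ext.{w} T S n) ≤ c) (X : C) :
    Module.length (End S) (Ext.{w} X S n) ≤ (l X * c : ℕ) := by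
  induction X using hl.induction_simple with
  | zero X hX =>
    have : Subsingleton (Ext.{w} X S n) := ⟨fun a b => by
      rw [← Ext.mk₀_id_comp a, ← Ext.mk₀_id_comp b, (IsZero.iff_id_eq_zero X).1 hX, Ext.mk₀_zero,
        Ext.zero_comp, Ext.zero_comp]⟩
    simp [Module.length_eq_zero]
  | ext X T p hp hT ih =>
    refine (length_ext_le_add (shortExact_kernel p) S n).trans
      ((add_le_add (hc T hT) ih).trans ?_)
    have h1 := hl.add_kernel p
    have h2 := hl.pos (Simple.not_isZero T)
    rw [← Nat.cast_add, h1, add_mul, add_comm]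
    have := Nat.mul_le_mul_right c h2
    exact_mod_cast (by omega)

/-- An object all of whose nonzero quotients map nontrivially to a given finite family of simple
objects has length bounded by its multiplicities in that family, if each member of the family is a
quotient of a projective object. -/
lemma le_mul_of_sum_length_le {ι : Type*} [Fintype ι] (S G : ι → C) [∀ k, Simple (S k)]
    [∀ k, Projective (G k)] (p : ∀ k, G k ⟶ S k) (hp : ∀ k, p k ≠ 0) (g : ℕ)
    (hg : ∀ k, l (G k) ≤ g) (d : ℕ) (W : C)
    (hW : ∀ (N : C) (q : W ⟶ N), Epi q → ¬ IsZero N → ∃ k, ∃ f : N ⟶ S k, f ≠ 0)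
    (hd : ∑ k, Module.length (End (S k)) (W ⟶ S k) ≤ d) : l W ≤ g * d := by
  induction d generalizing W with
  | zero =>
    rw [hl.eq_zero]
    · exact Nat.zero_le _
    by_contra h
    obtain ⟨k, f, hf⟩ := hW W (𝟙 W) inferInstance h
    have h0 : Module.length (End (S k)) (W ⟶ S k) ≤ 0 :=
      (Finset.single_le_sum (f := fun k => Module.length (End (S k)) (W ⟶ S k))
        (fun _ _ => zero_le) (Finset.mem_univ k)).trans (by simpa using hd)
    rw [nonpos_iff_eq_zero, Module.length_eq_zero_iff] at h0
    exact hf (h0.elim _ _)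
  | succ d ih =>
    by_cases h : IsZero W
    · rw [hl.eq_zero h]
      exact Nat.zero_le _
    obtain ⟨k, f, hf⟩ := hW W (𝟙 W) inferInstance h
    have : Epi f := epi_of_nonzero_to_simple hf
    -- Passing to `coker t` costs at most `g` in length. It lowers the total `Hom` length by at
    -- least one, as `f` does not vanish on the image of `t`.
    let t := Projective.factorThru (p k) f
    have ht : t ≫ f = p k := Projective.factorThru_comp _ _
    have hinj : ∀ k, Function.Injective (homPrecomp (cokernel.π t) (S k)) :=
      fun k a b hab => (cancel_epi (cokernel.π t)).1 hab
    have hk : Module.length (End (S k)) (cokernel t ⟶ S k) + 1 ≤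
        Module.length (End (S k)) (W ⟶ S k) := by
      refine length_add_one_le (homPrecomp (cokernel.π t) (S k)) (hinj k) f ?_
      rintro ⟨f', hf'⟩
      apply hp k
      rw [← ht, ← hf']
      exact (cokernel.condition_assoc t f').trans zero_comp
    have hsum : (∑ k, Module.length (End (S k)) (cokernel t ⟶ S k)) + 1 ≤
        ∑ k, Module.length (End (S k)) (W ⟶ S k) := by
      classical
      rw [← Finset.add_sum_erase _ _ (Finset.mem_univ k),
        ← Finset.add_sum_erase _ (fun k => Module.length (End (S k)) (W ⟶ S k))
          (Finset.mem_univ k), add_right_comm]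
      exact add_le_add hk (Finset.sum_le_sum fun k _ => Module.length_le_of_injective _ (hinj k))
    have h1 := ih (cokernel t) (fun N q hq hN => hW N (cokernel.π t ≫ q) (epi_comp _ _) hN) (by
      have := hsum.trans hd
      rw [Nat.cast_succ] at this
      exact (WithTop.add_le_add_iff_right WithTop.one_ne_top).1 this)
    have h2 := hl.le_add_cokernel t
    have h3 := hg k
    rw [mul_add]
    omega

end IsLengthFunction

lemma exists_length_ext_le [HasExt.{w} C] (hfin : HasFinitelyManySimples C)
    (hext : ∀ A B : C, Simple A → Simple B → Module.Finite (End B) (Ext.{w} A B 1)) (S : C)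
    [Simple S] : ∃ c : ℕ, ∀ T : C, Simple T → Module.length (End S) (Ext.{w} T S 1) ≤ c := by
  obtain ⟨n, F, hF, hF'⟩ := hfin
  have hne (i : Fin n) : Module.length (End S) (Ext.{w} (F i) S 1) ≠ ⊤ :=
    have := hext (F i) S (hF i) inferInstance
    length_ne_top_of_finite S
  choose c hc using fun i => ENat.ne_top_iff_exists.1 (hne i)
  refine ⟨∑ i, c i, fun T hT => ?_⟩
  obtain ⟨i, ⟨e⟩⟩ := hF' T hT
  have hinj : Function.Injective (extPrecomp.{w} e.inv S 1) := by
    intro x y hxy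
    have h : (Ext.mk₀ e.hom).comp ((Ext.mk₀ e.inv).comp x (zero_add 1)) (zero_add 1) =
        (Ext.mk₀ e.hom).comp ((Ext.mk₀ e.inv).comp y (zero_add 1)) (zero_add 1) :=
      congrArg (fun z => (Ext.mk₀ e.hom).comp z (zero_add 1)) hxy
    simpa using h
  refine (Module.length_le_of_injective _ hinj).trans ?_
  rw [← hc i]
  exact_mod_cast Finset.single_le_sum (fun _ _ => Nat.zero_le _) (Finset.mem_univ i)

end Hom

end AbelianRecollement

namespace AbelianRecollement

/-- If `h` were nonzero on `ker f`, then `ker h` would surject onto `M`; essentiality would give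
`ker h = X`, forcing `h = 0`. -/
lemma IsEssentialEpi.exists_fac_of_simple {C : Type u} [Category.{v} C] [Abelian C] {X M S : C}
    {f : X ⟶ M} (hf : IsEssentialEpi f) [Simple S] (h : X ⟶ S) : ∃ h', f ≫ h' = h := by
  have := hf.1
  suffices h0 : kernel.ι f ≫ h = 0 from ⟨Abelian.epiDesc f h h0, Abelian.comp_epiDesc f h h0⟩
  by_contra h0
  have : Epi (kernel.ι f ≫ h) := epi_of_nonzero_to_simple h0
  have : Epi h := epi_of_epi (kernel.ι f) h
  have : Epi (kernel.ι h) := hf.2 _ (epi_kernel_ι_comp f h)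
  apply h0
  rw [(cancel_epi (kernel.ι h)).1 ((kernel.condition h).trans comp_zero.symm), comp_zero]

/-! ### Bounding essential epimorphisms, and duality -/

namespace Recollement

variable {AZ : Type u₁} [Category.{v₁} AZ] [Abelian AZ] {A : Type u} [Category.{v} A] [Abelian A]
  {AU : Type u₂} [Category.{v₂} AU] [Abelian AU] (R : Recollement AZ A AU)

lemma isZero_iUpperStar_of_epi {X Y : A} (f : X ⟶ Y) [Epi f]
    (h : IsZero (R.iUpperStar.obj X)) : IsZero (R.iUpperStar.obj Y) :=
  h.of_epi (R.iUpperStar.map f)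

/-- By exactness this kernel is a quotient of `j_! j^* X`, which `i^*` kills. -/
lemma isZero_iUpperStar_kernel_unit (X : A) :
    IsZero (R.iUpperStar.obj (kernel (R.adjIStar.unit.app X))) := by
  obtain ⟨w, hex, -⟩ := R.exact_right X
  have := hex.epi_kernelLift
  exact R.isZero_iUpperStar_of_epi (kernel.lift _ _ w)
    (R.isZero_iUpperStar_jLowerShriek (R.jUpperStar.obj X))

lemma not_isZero_jUpperStar {X : A} (h : IsZero (R.iUpperStar.obj X)) (hX : ¬ IsZero X) :
    ¬ IsZero (R.jUpperStar.obj X) := fun h' =>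
  have := R.epi_counit_of_isZero h
  hX ((R.jLowerShriek.map_isZero h').of_epi (R.adjJShriek.counit.app X))

/-- If `X ⟶ M` is an essential epimorphism and `P` is a projective object covering `i^* M`, then
`i_* P` covers `i_* i^* X`. -/
lemma exists_epi_of_essential {X M : A} {f : X ⟶ M} (hf : IsEssentialEpi f) {P : AZ}
    [Projective P] (π : P ⟶ R.iUpperStar.obj M) [Epi π] :
    ∃ t : R.iLowerStar.obj P ⟶ R.iLowerStar.obj (R.iUpperStar.obj X), Epi t := by
  have := hf.1
  obtain ⟨t, rfl⟩ : ∃ t, t ≫ R.iUpperStar.map f = π := ⟨_, Projective.factorThru_comp _ _⟩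
  refine ⟨R.iLowerStar.map t, ?_⟩
  let uX : X ⟶ R.iLowerStar.obj (R.iUpperStar.obj X) := R.adjIStar.unit.app X
  let uM : M ⟶ R.iLowerStar.obj (R.iUpperStar.obj M) := R.adjIStar.unit.app M
  let cX : R.jLowerShriek.obj (R.jUpperStar.obj X) ⟶ X := R.adjJShriek.counit.app X
  let cM : R.jLowerShriek.obj (R.jUpperStar.obj M) ⟶ M := R.adjJShriek.counit.app M
  have : Epi uX := inferInstanceAs (Epi (R.adjIStar.unit.app X))
  have nu : f ≫ uM = uX ≫ R.iLowerStar.map (R.iUpperStar.map f) := R.adjIStar.unit.naturality f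
  have nc : R.jLowerShriek.map (R.jUpperStar.map f) ≫ cM = cX ≫ f :=
    R.adjJShriek.counit.naturality f
  have hc := pullback.condition (f := uX) (g := R.iLowerStar.map t)
  have hcu : cX ≫ uX = 0 := (R.exact_right X).1
  -- The pullback contains the image of `j_! j^* X`, so its image in `M` contains that of `j_! j^*
  -- M`; modulo the latter it is everything because `π` is epi. Essentiality of `f` then applies.
  have h1 : Epi (pullback.fst uX (R.iLowerStar.map t)) := by
    apply hf.2
    apply Preadditive.epi_of_cancel_zero
    intro T h hh
    rw [Category.assoc] at hh
    have h2 : cM ≫ h = 0 := by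
      rw [← cancel_epi (R.jLowerShriek.map (R.jUpperStar.map f)), reassoc_of% nc, comp_zero,
        ← pullback.lift_fst (f := uX) (g := R.iLowerStar.map t) cX 0 (by rw [hcu, zero_comp]),
        Category.assoc, hh, comp_zero]
    obtain ⟨w, hex, he⟩ := R.exact_right M
    obtain ⟨h', rfl⟩ : ∃ h', uM ≫ h' = h := ⟨hex.desc h h2, hex.g_desc h h2⟩
    rw [reassoc_of% nu, reassoc_of% hc, ← Functor.map_comp_assoc] at hh
    have h3 : h' = 0 := by
      rw [← cancel_epi (R.iLowerStar.map (t ≫ R.iUpperStar.map f)), comp_zero,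
        ← cancel_epi (pullback.snd uX (R.iLowerStar.map t)), hh, comp_zero]
    rw [h3, comp_zero]
  have h2 : Epi (pullback.snd uX (R.iLowerStar.map t) ≫ R.iLowerStar.map t) := by
    rw [← hc]
    exact epi_comp _ _
  exact epi_of_epi (pullback.snd uX (R.iLowerStar.map t)) _

theorem hasEnoughProjectives_of_closed_of_open [HasExt.{w} A] (R : Recollement AZ A AU) {l : A → ℕ}
    (hl : IsLengthFunction l) (hfin : HasFinitelyManySimples A)
    (hext : ∀ X Y : A, Simple X → Simple Y → Module.Finite (End Y) (Ext.{w} X Y 1))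
    (hZ : HasEnoughProjectives AZ) (hU : HasEnoughProjectives AU) : HasEnoughProjectives A := by
  classical
  intro M
  choose c hc using fun (S : A) (hS : Simple S) => exists_length_ext_le hfin hext S
  choose h hh using fun (S : A) (hS : Simple S) => ENat.ne_top_iff_exists.1 (hl.length_hom_ne_top S M)
  obtain ⟨n, F, hF, hF'⟩ := hfin
  obtain ⟨PZ, πZ, hPZ, hπZ, -⟩ := hZ (R.iUpperStar.obj M)
  choose P π hP using fun k => hU (R.jUpperStar.obj (F k))
  -- Only these simples can be quotients of the kernel of `X ⟶ i_* i^* X`, and they are the ones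
  -- reached by projectives `j_! P`.
  let ι := {k : Fin n // ¬ IsZero (R.jUpperStar.obj (F k))}
  have (k : ι) : Simple (F k) := hF k
  have (k : ι) : Projective (R.jLowerShriek.obj (P k)) :=
    R.adjJShriek.map_projective _ (hP k).1
  let p (k : ι) : R.jLowerShriek.obj (P k) ⟶ F k := (R.adjJShriek.homEquiv _ _).symm (π k)
  have hp (k : ι) : p k ≠ 0 := by
    intro h0
    have := R.adjJStar.isLeftAdjoint
    have h1 : π k = 0 := by
      rw [← (R.adjJShriek.homEquiv _ _).apply_symm_apply (π k)]
      change R.adjJShriek.homEquiv _ _ (p k) = 0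
      rw [h0, Adjunction.homEquiv_unit, CategoryTheory.Functor.map_zero, comp_zero]
    have := (hP k).2.1
    exact k.2 (IsZero.of_epi_eq_zero _ h1)
  -- These bounds depend only on `M`: `b` for `i_* i^* X`, `g` for the projectives `j_! P k`, and
  -- `d` for the total `Hom` length out of the kernel.
  let b := l (R.iLowerStar.obj PZ)
  let g := ∑ k : ι, l (R.jLowerShriek.obj (P k))
  let d := ∑ k : ι, (h (F k) (hF k) + b * c (F k) (hF k))
  refine hl.exists_projectiveCover M (g * d + b) fun X f hf => ?_
  obtain ⟨t, ht⟩ := R.exists_epi_of_essential hf πZ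
  have hb : l (R.iLowerStar.obj (R.iUpperStar.obj X)) ≤ b := hl.le_of_epi t
  let uX : X ⟶ R.iLowerStar.obj (R.iUpperStar.obj X) := R.adjIStar.unit.app X
  have : Epi uX := inferInstanceAs (Epi (R.adjIStar.unit.app X))
  rw [hl.add_kernel uX]
  refine add_le_add ?_ hb
  refine hl.le_mul_of_sum_length_le (fun k : ι => F k) (fun k => R.jLowerShriek.obj (P k)) p hp g
    (fun k => Finset.single_le_sum (f := fun k : ι => l (R.jLowerShriek.obj (P k)))
      (fun _ _ => Nat.zero_le _) (Finset.mem_univ k)) d _ ?_ ?_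
  · intro N q hq hN
    obtain ⟨T, r, hr, hT⟩ := hl.exists_simple_quotient hN
    obtain ⟨k, ⟨e⟩⟩ := hF' T hT
    have hk : ¬ IsZero (R.jUpperStar.obj (F k)) := fun hk =>
      R.not_isZero_jUpperStar (R.isZero_iUpperStar_of_epi (q ≫ r)
        (R.isZero_iUpperStar_kernel_unit X)) (Simple.not_isZero T)
        (hk.of_iso (R.jUpperStar.mapIso e))
    refine ⟨⟨k, hk⟩, r ≫ e.hom, fun h0 => Simple.not_isZero (F k) ?_⟩
    exact IsZero.of_epi_eq_zero (r ≫ e.hom) h0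
  · dsimp only [d]
    rw [Nat.cast_sum]
    refine Finset.sum_le_sum fun k _ => ?_
    refine (length_hom_le_add_ext (shortExact_kernel uX) (F k)).trans ?_
    rw [Nat.cast_add]
    refine add_le_add ?_ ?_
    -- Every map from `X` to a simple object factors through `f`, so `Hom(X, S)` is no longer than
    -- `Hom(M, S)`.
    · rw [hh]
      exact Module.length_le_of_surjective (homPrecomp f (F k))
        fun y => hf.exists_fac_of_simple y
    · refine (hl.length_ext_le_mul (F k) 1 (c (F k) (hF k)) (hc _ _) _).trans ?_
      exact_mod_cast Nat.mul_le_mul_right _ hb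

theorem hasEnoughProjectives_iff [HasExt.{w} A] (R : Recollement AZ A AU) {l : A → ℕ}
    (hl : IsLengthFunction l) (hfin : HasFinitelyManySimples A)
    (hext : ∀ X Y : A, Simple X → Simple Y → Module.Finite (End Y) (Ext.{w} X Y 1)) :
    HasEnoughProjectives A ↔ HasEnoughProjectives AZ ∧ HasEnoughProjectives AU :=
  ⟨fun h => ⟨R.hasEnoughProjectives_closed h, R.hasEnoughProjectives_open h⟩,
    fun h => R.hasEnoughProjectives_of_closed_of_open hl hfin hext h.1 h.2⟩

/-- The opposite recollement, which exchanges the two outer adjoints on either side. -/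
def op : Recollement AZᵒᵖ Aᵒᵖ AUᵒᵖ where
  iLowerStar := R.iLowerStar.op
  iUpperStar := R.iUpperShriek.op
  iUpperShriek := R.iUpperStar.op
  jUpperStar := R.jUpperStar.op
  jLowerShriek := R.jLowerStar.op
  jLowerStar := R.jLowerShriek.op
  adjIStar := R.adjIShriek.op
  adjIShriek := R.adjIStar.op
  adjJShriek := R.adjJStar.op
  adjJStar := R.adjJShriek.op
  full_iLowerStar := inferInstance
  faithful_iLowerStar := inferInstance
  full_jLowerShriek := inferInstance
  faithful_jLowerShriek := inferInstance
  full_jLowerStar := inferInstance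
  faithful_jLowerStar := inferInstance
  isZero_jUpperStar_iLowerStar Z := (R.isZero_jUpperStar_iLowerStar Z.unop).op
  exact_right X := by
    obtain ⟨w, hex, hm⟩ := R.exact_left X.unop
    exact ⟨congrArg Quiver.Hom.op w, hex.op,
      inferInstanceAs (Epi (R.adjIShriek.counit.app X.unop).op)⟩
  exact_left X := by
    obtain ⟨w, hex, hm⟩ := R.exact_right X.unop
    exact ⟨congrArg Quiver.Hom.op w, hex.op,
      inferInstanceAs (Mono (R.adjIStar.unit.app X.unop).op)⟩

end Recollement

/-! ### Passage to the opposite category -/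

section Opposite

lemma isInjectiveEnvelope_iff_op {C : Type u} [Category.{v} C] {X I : C} (f : X ⟶ I) :
    IsInjectiveEnvelope f ↔ IsProjectiveCover f.op := by
  refine and_congr (Injective.injective_iff_projective_op) (and_congr ?_ ?_)
  · exact ⟨fun _ => inferInstance, fun _ => unop_mono_of_epi f.op⟩
  · refine ⟨fun h X' α hα => ?_, fun h Y' β hβ => ?_⟩
    · have := h α.unop (unop_mono_of_epi (α ≫ f.op))
      exact inferInstanceAs (Epi α.unop.op)
    · have := h β.op (inferInstanceAs (Epi (f ≫ β).op))
      exact unop_mono_of_epi β.op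

lemma hasEnoughInjectives_iff_op (C : Type u) [Category.{v} C] :
    HasEnoughInjectives C ↔ HasEnoughProjectives Cᵒᵖ := by
  refine ⟨fun h X => ?_, fun h X => ?_⟩
  · obtain ⟨I, f, hf⟩ := h X.unop
    exact ⟨_, f.op, (isInjectiveEnvelope_iff_op f).1 hf⟩
  · obtain ⟨P, f, hf⟩ := h (.op X)
    exact ⟨_, f.unop, (isInjectiveEnvelope_iff_op f.unop).2 hf⟩

variable {C : Type u} [Category.{v} C] [Abelian C]

lemma simple_op (X : C) [Simple X] : Simple (Opposite.op X) where
  mono_isIso_iff_nonzero {Y} f hf := by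
    have : Epi f.unop := unop_epi_of_mono f
    rw [← isIso_unop_iff]
    refine ⟨?_, fun h => isIso_of_epi_of_nonzero fun h0 => h (Quiver.Hom.unop_inj h0)⟩
    rintro hi rfl
    have : IsIso (0 : X ⟶ Y.unop) := hi
    exact Simple.not_isZero X (IsZero.of_mono_eq_zero (0 : X ⟶ Y.unop) rfl)

lemma simple_unop (X : Cᵒᵖ) [Simple X] : Simple X.unop := by
  refine simple_of_cosimple _ fun {Z} f hf => ?_
  rw [← isIso_op_iff, Simple.mono_isIso_iff_nonzero f.op]
  exact not_congr ⟨fun h => Quiver.Hom.op_inj h, fun h => congrArg Quiver.Hom.op h⟩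

lemma HasFinitelyManySimples.op (h : HasFinitelyManySimples C) : HasFinitelyManySimples Cᵒᵖ := by
  obtain ⟨n, S, hS, hS'⟩ := h
  refine ⟨n, fun i => .op (S i), fun i => have := hS i; simple_op _, fun X hX => ?_⟩
  obtain ⟨i, ⟨e⟩⟩ := hS' X.unop (simple_unop X)
  exact ⟨i, ⟨e.symm.op⟩⟩

lemma IsLengthFunction.op {l : C → ℕ} (hl : IsLengthFunction l) :
    IsLengthFunction fun X : Cᵒᵖ => l X.unop where
  add S hS := (hl.add S.unop hS.unop).trans (add_comm _ _)
  isZero _ hX := (hl.isZero _ hX).op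

end Opposite

end AbelianRecollement

theorem theorem4p6
    {AZ : Type u₁} [Category.{v₁} AZ] [Abelian AZ]
    {A : Type u} [Category.{v} A] [Abelian A]
    {AU : Type u₂} [Category.{v₂} AU] [Abelian AU]
    (R : AbelianRecollement.Recollement AZ A AU)
    (hlen : AbelianRecollement.IsLengthCategory A)
    (hfin : AbelianRecollement.HasFinitelyManySimples A) :
    (AbelianRecollement.IsExtFinite A 1 →
      (AbelianRecollement.HasEnoughProjectives A ↔
        AbelianRecollement.HasEnoughProjectives AZ ∧
          AbelianRecollement.HasEnoughProjectives AU)) ∧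
    (AbelianRecollement.IsExtFinite Aᵒᵖ 1 →
      (AbelianRecollement.HasEnoughInjectives A ↔
        AbelianRecollement.HasEnoughInjectives AZ ∧
          AbelianRecollement.HasEnoughInjectives AU)) := by
  obtain ⟨l, hl⟩ := hlen.exists_isLengthFunction
  refine ⟨fun hext => ?_, fun hext => ?_⟩
  · let := HasExt.standard A
    exact R.hasEnoughProjectives_iff hl hfin hext
  · let := HasExt.standard Aᵒᵖ
    simp only [AbelianRecollement.hasEnoughInjectives_iff_op]
    exact R.op.hasEnoughProjectives_iff hl.op hfin.op hext
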